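/- Let $P$ be a simple $d$-polytope, that is, the convex hull of a nonempty finite set of points in a finite-dimensional real normed space, of affine dimension $d$, such that every vertex of $P$ lies on exactly $d$ edges of $P$. Let $G_P$ be its vertex-edge graph. For an orientation $\mathcal O$ of $G_P$ let $h_i(\mathcal O)$ be the number of vertices with exactly $i$ incident edges directed inwards, and put $$H_2(\mathcal O)=\sum_{i=0}^d h_i(\mathcal O)\binom i2 .$$ A *2-system* of $G_P$ is a set $\mathcal S$ of nonempty sets of vertices such that each $S\in\mathcal S$ induces a $2$-regular subgraph of $G_P$ and such that, for every vertex $v$ and any two distinct neighbours $u,w$ of $v$, the set $\{u,v,w\}$ is contained in exactly one member of $\mathcal S$. An *AOF-orientation* is an acyclic orientation of $G_P$ that induces exactly one sink on the vertex set of every nonempty face of $P$ (including $P$ itself). Let $\mathcal O$ be an acyclic orientation of $G_P$. Then exactly one of the following holds: 1. there is a 2-system $\mathcal S$ of $G_P$ with $|\mathcal S|=H_2(\mathcal O)$; 2. there is an acyclic orientation $\mathcal O'$ of $G_P$ with $H_2(\mathcal O')<H_2(\mathcal O)$. In case 1, $\mathcal O$ is an AOF-orientation; in case 2, it is not. -/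

import Mathlib

/-! ## Orientations of graphs and `k`-systems -/

/-- An orientation of a simple graph `G`: every edge is given exactly one of its two directions.
`arc u v` means that the edge `{u, v}` is directed from `u` to `v`. -/
structure GraphOrientation {V : Type*} (G : SimpleGraph V) where
  arc : V → V → Prop
  adj_iff : ∀ u v, G.Adj u v ↔ arc u v ∨ arc v u
  asymm : ∀ u v, arc u v → ¬ arc v u

namespace GraphOrientation

variable {V : Type*} {G : SimpleGraph V}

/-- There is no directed cycle (no nontrivial directed closed walk). -/
def Acyclic (O : GraphOrientation G) : Prop :=
  ∀ v, ¬ Relation.TransGen O.arc v v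

/-- `w` is a sink of the orientation induced on the subgraph of `G` induced by `W`. -/
def IsSinkOn (O : GraphOrientation G) (W : Set V) (w : V) : Prop :=
  w ∈ W ∧ ∀ u ∈ W, ¬ O.arc w u

/-- The number of edges at `v` that are directed towards `v`. -/
noncomputable def inDegree (O : GraphOrientation G) (v : V) : ℕ :=
  {u | O.arc u v}.ncard

/-- `h_i(O)`: the number of vertices with precisely `i` incident edges directed inwards. -/
noncomputable def h (O : GraphOrientation G) (i : ℕ) : ℕ :=
  {v | O.inDegree v = i}.ncard

/-- `H_k(O) = ∑_{i=0}^d h_i(O) * binom(i, k)`. -/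
noncomputable def H (O : GraphOrientation G) (d k : ℕ) : ℕ :=
  ∑ i ∈ Finset.range (d + 1), O.h i * i.choose k

end GraphOrientation

/-- A `k`-frame of `G`: a subgraph that is a star `K_{1,k}`, given by its root `r` and the set `L`
of its `k` leaves, which are neighbours of `r`. -/
def IsKFrame {V : Type*} (G : SimpleGraph V) (k : ℕ) (r : V) (L : Set V) : Prop :=
  L ⊆ G.neighborSet r ∧ L.Finite ∧ L.ncard = k

/-- A `k`-system of `G`: a collection of nonempty vertex sets, each inducing a `k`-regular subgraph,
such that the node set of every `k`-frame is contained in a unique member. -/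
def IsKSystem {V : Type*} (G : SimpleGraph V) (k : ℕ) (S : Set (Set V)) : Prop :=
  (∀ W ∈ S, W.Nonempty ∧ ∀ w : W, ((G.induce W).neighborSet w).ncard = k) ∧
    ∀ (r : V) (L : Set V), IsKFrame G k r L → ∃! W, W ∈ S ∧ insert r L ⊆ W

/-! ## Polytopes -/

section Polytope

variable {E : Type*} [NormedAddCommGroup E] [NormedSpace ℝ E]

/-- The graph of a polytope `P`. Its nodes are the vertices (the points `v` such that `{v}` is a
face of `P`); two different vertices are adjacent if the segment joining them is a face of `P`. -/
def polytopeGraph (P : Set E) : SimpleGraph (P.exposedPoints ℝ) where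
  Adj v w := v ≠ w ∧ IsExposed ℝ P (segment ℝ (v : E) (w : E))
  symm := ⟨fun v w hvw => ⟨hvw.1.symm, by rw [segment_symm]; exact hvw.2⟩⟩
  loopless := ⟨fun v hv => hv.1 rfl⟩

/-- `P` is a simple `d`-polytope: the convex hull of a nonempty finite set of points, of affine
dimension `d`, such that every vertex lies on precisely `d` edges. -/
structure IsSimplePolytope (P : Set E) (d : ℕ) : Prop where
  polytope : ∃ s : Finset E, P = convexHull ℝ (s : Set E)
  nonempty : P.Nonempty
  dim_eq : Module.finrank ℝ (vectorSpan ℝ P) = d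
  degree_eq : ∀ v : P.exposedPoints ℝ, ((polytopeGraph P).neighborSet v).ncard = d

/-- The set of the vertices of `P` that lie on the face `F`. -/
def faceVertices (P F : Set E) : Set (P.exposedPoints ℝ) :=
  {v | (v : E) ∈ F}

/-- An AOF-orientation of the graph of `P`: an acyclic orientation that induces a unique sink in
every nonempty face of `P` (`P` itself included). -/
def IsAOFOrientation (P : Set E) (O : GraphOrientation (polytopeGraph P)) : Prop :=
  O.Acyclic ∧ ∀ F : Set E, IsExposed ℝ P F → F.Nonempty → ∃! w, O.IsSinkOn (faceVertices P F) w

end Polytope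

/-! ### Sinks of acyclic orientations and counting of in-frames. -/

namespace GraphOrientation

variable {V : Type*} {G : SimpleGraph V}

/-! The theorem is a min-max duality. For an acyclic `O`, `H_2(O)` counts the pairs of arcs entering
a common vertex. Sending each pair to the member of a 2-system `S` that contains it is surjective,
since every member has a sink. Hence `|S| ≤ H_2(O)`, with equality iff every member has one sink
(`IsKSystem.ncard_le`, `IsKSystem.ncard_eq_iff`).

The 2-faces form a 2-system (`IsSimplePolytope.isKSystem_faceSystem`), and a generic linear
functional gives an AOF-orientation (`exists_isAOFOrientation`), so the number of 2-faces is both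
the maximum of `|S|` and the minimum of `H_2`. An acyclic `O` attains it or is beaten.

Attaining it means unique sinks on 2-faces; a confluence argument (`Acyclic.existsUnique_isSinkOn`)
extends this to all faces. The geometry rests on `sub_mem_hull_neighborSet`: local maxima of linear
functionals are global. -/

theorem Acyclic.wellFounded [Finite V] {O : GraphOrientation G} (hO : O.Acyclic) :
    WellFounded (fun a b => O.arc b a) := by
  have hI : Std.Irrefl (fun a b => Relation.TransGen O.arc b a) := ⟨fun v => hO v⟩
  have hT : IsTrans V (fun a b => Relation.TransGen O.arc b a) := ⟨fun a b c h₁ h₂ => h₂.trans h₁⟩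
  exact Subrelation.wf (r := fun a b => Relation.TransGen O.arc b a)
    (fun h => Relation.TransGen.single h) (Finite.wellFounded_of_trans_of_irrefl _)

theorem Acyclic.exists_isSinkOn [Finite V] {O : GraphOrientation G} (hO : O.Acyclic)
    {W : Set V} (hW : W.Nonempty) : ∃ w, O.IsSinkOn W w := by
  obtain ⟨w, hw, hmin⟩ := hO.wellFounded.has_min W hW
  exact ⟨w, hw, fun u hu => hmin u hu⟩

/-- From every vertex of `W` a directed path inside `W` leads to a sink of `W`. -/
theorem Acyclic.exists_reachable_isSinkOn [Finite V] {O : GraphOrientation G} (hO : O.Acyclic)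
    {W : Set V} {v : V} (hv : v ∈ W) :
    ∃ w, O.IsSinkOn W w ∧ Relation.ReflTransGen (fun x y => O.arc x y ∧ y ∈ W) v w := by
  obtain ⟨w, ⟨hw, hvw⟩, hmin⟩ := hO.exists_isSinkOn
    (W := {x | x ∈ W ∧ Relation.ReflTransGen (fun x y => O.arc x y ∧ y ∈ W) v x}) ⟨v, hv, .refl⟩
  exact ⟨w, ⟨hw, fun u hu h => hmin u ⟨hu, hvw.tail ⟨h, hu⟩⟩ h⟩, hvw⟩

/-- Newman's lemma: acyclicity gives termination, and the sink of `T` is the common successor that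
gives local confluence. -/
theorem Acyclic.eq_of_reachable_isSinkOn [Finite V] {O : GraphOrientation G} (hO : O.Acyclic)
    {W : Set V}
    (h2 : ∀ v ∈ W, ∀ u ∈ W, ∀ w ∈ W, u ≠ w → O.arc v u → O.arc v w →
      ∃ T ⊆ W, u ∈ T ∧ w ∈ T ∧ ∃! t, O.IsSinkOn T t) {v s s' : V} (hv : v ∈ W)
    (hs : O.IsSinkOn W s) (hvs : Relation.ReflTransGen (fun x y => O.arc x y ∧ y ∈ W) v s)
    (hs' : O.IsSinkOn W s') (hvs' : Relation.ReflTransGen (fun x y => O.arc x y ∧ y ∈ W) v s') :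
    s = s' := by
  induction v using hO.wellFounded.induction generalizing s s' with
  | _ v ih =>
  rcases hvs.cases_head with rfl | ⟨u, ⟨hvu, hu⟩, hus⟩
  · rcases hvs'.cases_head with rfl | ⟨w, ⟨hvw, hw⟩, -⟩
    · rfl
    · exact absurd hvw (hs.2 w hw)
  rcases hvs'.cases_head with rfl | ⟨w, ⟨hvw, hw⟩, hws⟩
  · exact absurd hvu (hs'.2 u hu)
  by_cases huw : u = w
  · subst huw
    exact ih u hvu hu hs hus hs' hws
  obtain ⟨T, hTW, huT, hwT, t, ht, htu⟩ := h2 v hv u hu w hw huw hvu hvw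
  have key : ∀ x ∈ T, Relation.ReflTransGen (fun x y => O.arc x y ∧ y ∈ W) x t := by
    intro x hx
    obtain ⟨t', ht', hxt'⟩ := hO.exists_reachable_isSinkOn hx
    rw [← htu t' ht']
    exact Relation.ReflTransGen.mono (fun a b hab => ⟨hab.1, hTW hab.2⟩) _ _ hxt'
  obtain ⟨s₀, hs₀, hts₀⟩ := hO.exists_reachable_isSinkOn (hTW ht.1)
  exact (ih u hvu hu hs hus hs₀ ((key u huT).trans hts₀)).trans
    (ih w hvw hw hs₀ ((key w hwT).trans hts₀) hs' hws)

/-- If `W` is connected and any two arcs of `W` that leave the same vertex lie in a subset of `W`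
with a unique sink, then `W` has a unique sink. -/
theorem Acyclic.existsUnique_isSinkOn [Finite V] {O : GraphOrientation G} (hO : O.Acyclic)
    {W : Set V}
    (h2 : ∀ v ∈ W, ∀ u ∈ W, ∀ w ∈ W, u ≠ w → O.arc v u → O.arc v w →
      ∃ T ⊆ W, u ∈ T ∧ w ∈ T ∧ ∃! t, O.IsSinkOn T t) {b : V} (hb : b ∈ W)
    (hconn : ∀ a ∈ W, Relation.ReflTransGen (fun x y => G.Adj x y ∧ y ∈ W) a b) :
    ∃! w, O.IsSinkOn W w := by
  obtain ⟨s₀, hs₀, hbs₀⟩ := hO.exists_reachable_isSinkOn hb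
  -- Adjacent vertices reach the same sink, because the tail of the arc between them also reaches
  -- whatever its head reaches.
  have key : ∀ a, Relation.ReflTransGen (fun x y => G.Adj x y ∧ y ∈ W) a b → a ∈ W →
      ∀ s, O.IsSinkOn W s → Relation.ReflTransGen (fun x y => O.arc x y ∧ y ∈ W) a s →
        s = s₀ := by
    intro a hab
    induction hab using Relation.ReflTransGen.head_induction_on with
    | refl =>
      intro ha s hs has
      exact hO.eq_of_reachable_isSinkOn h2 ha hs has hs₀ hbs₀
    | head hxy hyb ih =>
      rename_i x y
      intro hx s hs hxs
      rcases (O.adj_iff x y).1 hxy.1 with h | h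
      · obtain ⟨t, ht, hyt⟩ := hO.exists_reachable_isSinkOn hxy.2
        rw [← ih hxy.2 t ht hyt]
        exact hO.eq_of_reachable_isSinkOn h2 hx hs hxs ht (hyt.head ⟨h, hxy.2⟩)
      · exact ih hxy.2 s hs (hxs.head ⟨h, hx⟩)
  exact ⟨s₀, hs₀, fun s hs => key s (hconn s hs.1) hs.1 s hs .refl⟩

/-- The pairs of a vertex and a set of `k` of its in-neighbours. -/
def inFrames (O : GraphOrientation G) (k : ℕ) : Set (V × Finset V) :=
  {f | (∀ u ∈ f.2, O.arc u f.1) ∧ f.2.card = k}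

theorem inDegree_le_ncard_neighborSet [Finite V] (O : GraphOrientation G) (v : V) :
    O.inDegree v ≤ (G.neighborSet v).ncard :=
  Set.ncard_le_ncard (fun u hu => (O.adj_iff v u).2 (Or.inr hu)) (Set.toFinite _)

/-- A vertex of in-degree `i` is the root of `i.choose k` in-frames, and `i ≤ d`. -/
theorem ncard_inFrames [Finite V] (O : GraphOrientation G) {d : ℕ}
    (hd : ∀ v, (G.neighborSet v).ncard = d) (k : ℕ) : (O.inFrames k).ncard = O.H d k := by
  classical
  have := Fintype.ofFinite V
  have h1 : ∀ v, ({u | O.arc u v} : Finset V).card = O.inDegree v := by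
    intro v
    rw [inDegree, ← Set.ncard_coe_finset]
    congr 1
    ext; simp
  have h2 : O.inFrames k = ((Finset.univ.sigma fun v =>
      ({u | O.arc u v} : Finset V).powersetCard k).map
        (Equiv.sigmaEquivProd V (Finset V)).toEmbedding : Finset (V × Finset V)) := by
    ext ⟨v, L⟩
    simp [inFrames, Finset.mem_powersetCard, Finset.subset_iff, Equiv.sigmaEquivProd]
  rw [h2, Set.ncard_coe_finset, Finset.card_map, Finset.card_sigma]
  simp only [Finset.card_powersetCard, h1]
  have hmem : ∀ v ∈ (Finset.univ : Finset V), O.inDegree v ∈ Finset.range (d + 1) := fun v _ =>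
    Finset.mem_range.2 (Nat.lt_succ_of_le (hd v ▸ O.inDegree_le_ncard_neighborSet v))
  rw [← Finset.sum_fiberwise_of_maps_to hmem]
  refine Finset.sum_congr rfl fun i _ => ?_
  rw [Finset.sum_congr rfl fun v hv => by rw [(Finset.mem_filter.1 hv).2], Finset.sum_const,
    smul_eq_mul, h, ← Set.ncard_coe_finset]
  congr 2
  ext; simp

end GraphOrientation

/-! ### The bound of a `k`-system by `H_k`, and its equality case. -/

section KSystem

variable {V : Type*} {G : SimpleGraph V} {O : GraphOrientation G} {S : Set (Set V)}

theorem ncard_neighborSet_induce (W : Set V) (w : W) :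
    ((G.induce W).neighborSet w).ncard = (G.neighborSet w ∩ W).ncard := by
  rw [← Set.ncard_image_of_injective _ Subtype.val_injective]
  congr 1
  ext u
  simp

theorem IsKSystem.ncard_neighborSet_inter {k : ℕ} (hS : IsKSystem G k S) {W : Set V} (hW : W ∈ S)
    {w : V} (hw : w ∈ W) : (G.neighborSet w ∩ W).ncard = k := by
  rw [← ncard_neighborSet_induce W ⟨w, hw⟩]
  exact (hS.1 W hW).2 ⟨w, hw⟩

/-- The member of a `k`-system that contains a frame meets the neighbours of its root in the leaves
of the frame. -/
theorem IsKSystem.neighborSet_inter_eq [Finite V] {k : ℕ} (hS : IsKSystem G k S) {W : Set V}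
    (hW : W ∈ S) {r : V} {L : Set V} (hL : IsKFrame G k r L) (hrL : insert r L ⊆ W) :
    G.neighborSet r ∩ W = L := by
  symm
  apply Set.eq_of_subset_of_ncard_le
    (Set.subset_inter hL.1 ((Set.subset_insert r L).trans hrL))
  rw [hS.ncard_neighborSet_inter hW (hrL (Set.mem_insert r L)), hL.2.2]

/-- `φ f` is the member containing the frame `f`. The root has no neighbours in it besides the
leaves, so it is a sink. Conversely, a sink of a member and its `k` neighbours there form an
in-frame. -/
theorem IsKSystem.exists_inFrames_map [Finite V] {k : ℕ} (hS : IsKSystem G k S)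
    (hO : O.Acyclic) : ∃ φ : V × Finset V → Set V, φ '' O.inFrames k = S ∧
      (∀ f ∈ O.inFrames k, O.IsSinkOn (φ f) f.1 ∧ G.neighborSet f.1 ∩ φ f = f.2) ∧
      ∀ W ∈ S, ∀ w, O.IsSinkOn W w → ∃ f ∈ O.inFrames k, f.1 = w ∧ φ f = W := by
  classical
  have hfr : ∀ f ∈ O.inFrames k, IsKFrame G k f.1 (f.2 : Set V) := fun f hf =>
    ⟨fun u hu => (O.adj_iff _ _).2 (Or.inr (hf.1 u hu)), f.2.finite_toSet, by
      rw [Set.ncard_coe_finset, hf.2]⟩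
  choose! φ hφ hφu using fun f (hf : f ∈ O.inFrames k) => hS.2 f.1 f.2 (hfr f hf)
  have hN : ∀ f ∈ O.inFrames k, G.neighborSet f.1 ∩ φ f = f.2 := fun f hf =>
    hS.neighborSet_inter_eq (hφ f hf).1 (hfr f hf) (hφ f hf).2
  have hsink : ∀ W ∈ S, ∀ w, O.IsSinkOn W w → ∃ f ∈ O.inFrames k, f.1 = w ∧ φ f = W := by
    intro W hW w hw
    have hfin := Set.toFinite (G.neighborSet w ∩ W)
    have hf : (w, hfin.toFinset) ∈ O.inFrames k := by
      refine ⟨fun u hu => ?_, ?_⟩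
      · rw [Set.Finite.mem_toFinset] at hu
        exact ((O.adj_iff w u).1 hu.1).resolve_left (hw.2 u hu.2)
      · rw [← Set.ncard_eq_toFinset_card, hS.ncard_neighborSet_inter hW hw.1]
    refine ⟨_, hf, rfl, (hφu _ hf W ⟨hW, ?_⟩).symm⟩
    rw [Set.Finite.coe_toFinset]
    exact Set.insert_subset hw.1 Set.inter_subset_right
  refine ⟨φ, ?_, fun f hf => ⟨⟨(hφ f hf).2 (Set.mem_insert _ _), fun u hu h => ?_⟩, hN f hf⟩,
    hsink⟩
  · apply Set.Subset.antisymm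
    · rintro _ ⟨f, hf, rfl⟩
      exact (hφ f hf).1
    · intro W hW
      obtain ⟨w, hw⟩ := hO.exists_isSinkOn (hS.1 W hW).1
      obtain ⟨f, hf, -, rfl⟩ := hsink W hW w hw
      exact ⟨f, hf, rfl⟩
  · have hu' : u ∈ G.neighborSet f.1 ∩ φ f := ⟨(O.adj_iff _ _).2 (Or.inl h), hu⟩
    rw [hN f hf] at hu'
    exact O.asymm _ _ h (hf.1 u hu')

theorem IsKSystem.ncard_le [Finite V] {k d : ℕ} (hS : IsKSystem G k S) (hO : O.Acyclic)
    (hd : ∀ v, (G.neighborSet v).ncard = d) : S.ncard ≤ O.H d k := by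
  obtain ⟨φ, hφ, -⟩ := hS.exists_inFrames_map hO
  rw [← hφ, ← O.ncard_inFrames hd]
  exact Set.ncard_image_le (Set.toFinite _)

/-- Equality means that `φ` is injective. A member and one of its sinks determine the frame, so this
amounts to uniqueness of sinks. -/
theorem IsKSystem.ncard_eq_iff [Finite V] {k d : ℕ} (hS : IsKSystem G k S) (hO : O.Acyclic)
    (hd : ∀ v, (G.neighborSet v).ncard = d) :
    S.ncard = O.H d k ↔ ∀ W ∈ S, ∃! w, O.IsSinkOn W w := by
  obtain ⟨φ, hφ, hφs, hsink⟩ := hS.exists_inFrames_map hO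
  rw [← O.ncard_inFrames hd]
  constructor
  · intro h W hW
    have hinj : Set.InjOn φ (O.inFrames k) := Set.injOn_of_ncard_image_eq (by rw [hφ, h])
    obtain ⟨w, hw⟩ := hO.exists_isSinkOn (hS.1 W hW).1
    refine ⟨w, hw, fun w' hw' => ?_⟩
    obtain ⟨f, hf, rfl, hfW⟩ := hsink W hW w hw
    obtain ⟨f', hf', rfl, hfW'⟩ := hsink W hW w' hw'
    rw [hinj hf hf' (hfW.trans hfW'.symm)]
  · intro h
    rw [← hφ]
    refine Set.InjOn.ncard_image fun f hf f' hf' hff' => ?_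
    have h1 : f.1 = f'.1 := (h (φ f) (hφ ▸ ⟨f, hf, rfl⟩)).unique (hφs f hf).1
      (hff' ▸ (hφs f' hf').1)
    refine Prod.ext h1 (Finset.coe_injective ?_)
    rw [← (hφs f hf).2, ← (hφs f' hf').2, hff', h1]

end KSystem

/-! ### Exposed faces of polytopes and the cone at a vertex. -/

section Faces

variable {E : Type*} [NormedAddCommGroup E] [NormedSpace ℝ E]

theorem IsExposed.exists_functional {P F : Set E} (hF : IsExposed ℝ P F) {x : E} (hx : x ∈ F) :
    ∃ l : StrongDual ℝ E, (∀ y ∈ P, l y ≤ l x) ∧ F = {y ∈ P | l y = l x} := by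
  obtain ⟨l, rfl⟩ := hF ⟨x, hx⟩
  refine ⟨l, hx.2, ?_⟩
  ext y
  exact ⟨fun hy => ⟨hy.1, le_antisymm (hx.2 y hy.1) (hy.2 x hx.1)⟩,
    fun hy => ⟨hy.1, fun z hz => (hx.2 z hz).trans hy.2.ge⟩⟩

theorem isExposed_of_functional {P : Set E} {M : ℝ} (l : StrongDual ℝ E) (hl : ∀ y ∈ P, l y ≤ M) :
    IsExposed ℝ P {y ∈ P | l y = M} := by
  rintro ⟨x, hx, rfl⟩
  refine ⟨l, ?_⟩
  ext y
  exact ⟨fun hy => ⟨hy.1, fun z hz => (hl z hz).trans hy.2.ge⟩,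
    fun hy => ⟨hy.1, le_antisymm (hl y hy.1) (hy.2 x hx)⟩⟩

theorem le_of_mem_convexHull {s : Set E} {M : ℝ} (l : StrongDual ℝ E) (hl : ∀ p ∈ s, l p ≤ M) {x : E}
    (hx : x ∈ convexHull ℝ s) : l x ≤ M :=
  convexHull_min (t := {x | l x ≤ M}) hl (convex_halfSpace_le l.isLinear M) hx

/-- The face of `convexHull ℝ s` on which `l` attains its maximum. -/
theorem convexHull_inter_eq {s : Set E} {M : ℝ} (l : StrongDual ℝ E) (hl : ∀ p ∈ s, l p ≤ M) :
    {x ∈ convexHull ℝ s | l x = M} = convexHull ℝ {p ∈ s | l p = M} := by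
  apply Set.Subset.antisymm
  · rintro x ⟨hx, hxM⟩
    -- This condition is convex: a combination with positive weights attains `M` only if both points
    -- do.
    have key : convexHull ℝ s ⊆ {x | l x ≤ M ∧ (l x = M → x ∈ convexHull ℝ {p ∈ s | l p = M})} := by
      apply convexHull_min
      · exact fun p hp => ⟨hl p hp, fun h => subset_convexHull ℝ _ ⟨hp, h⟩⟩
      · rintro x ⟨hx, hx'⟩ y ⟨hy, hy'⟩ α β hα hβ hαβ
        rcases hα.eq_or_lt with rfl | hα
        · obtain rfl : β = 1 := by linarith
          simpa using ⟨hy, hy'⟩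
        rcases hβ.eq_or_lt with rfl | hβ
        · obtain rfl : α = 1 := by linarith
          simpa using ⟨hx, hx'⟩
        have e : l (α • x + β • y) = α * l x + β * l y := by simp
        have h1 : 0 ≤ α * (M - l x) := mul_nonneg hα.le (by linarith)
        have h2 : 0 ≤ β * (M - l y) := mul_nonneg hβ.le (by linarith)
        have h3 : α * M + β * M = M := by rw [← add_mul, hαβ, one_mul]
        refine ⟨by rw [e]; linarith, fun h => ?_⟩
        rw [e] at h
        have h1' : M - l x = 0 := (mul_eq_zero.1 (by linarith : α * (M - l x) = 0)).resolve_left hα.ne'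
        have h2' : M - l y = 0 := (mul_eq_zero.1 (by linarith : β * (M - l y) = 0)).resolve_left hβ.ne'
        exact convex_convexHull ℝ _ (hx' (by linarith)) (hy' (by linarith)) hα.le hβ.le hαβ
    exact (key hx).2 hxM
  · exact convexHull_min (fun p hp => ⟨subset_convexHull ℝ _ hp.1, hp.2⟩)
      ((convex_convexHull ℝ s).inter (convex_hyperplane l.isLinear M))

theorem IsExposed.eq_convexHull {s F : Set E} (hF : IsExposed ℝ (convexHull ℝ s) F) :
    F = convexHull ℝ (s ∩ F) := by
  rcases F.eq_empty_or_nonempty with rfl | ⟨x, hx⟩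
  · simp
  obtain ⟨l, hl, hFl⟩ := hF.exists_functional hx
  have h := convexHull_inter_eq l (fun p hp => hl p (subset_convexHull ℝ _ hp))
  rw [← hFl] at h
  rw [h]
  congr 1
  ext p
  rw [← h, hFl]
  exact ⟨fun hp => ⟨hp.1, subset_convexHull ℝ _ hp.1, hp.2⟩, fun hp => ⟨hp.1, hp.2.2⟩⟩

/-- Maximise `l` first and `m` second: `N • l + m` does both at once for large `N`. Finiteness of
`s` provides a uniform `N`; for general convex sets the statement fails. -/
theorem IsExposed.trans_of_finite {s B C : Set E} (hs : s.Finite)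
    (hB : IsExposed ℝ (convexHull ℝ s) B) (hC : IsExposed ℝ B C) :
    IsExposed ℝ (convexHull ℝ s) C := by
  rcases C.eq_empty_or_nonempty with rfl | ⟨x, hx⟩
  · exact isExposed_empty
  obtain ⟨l, hl, hBl⟩ := hB.exists_functional (hC.subset hx)
  obtain ⟨m, hm, hCm⟩ := hC.exists_functional hx
  have hls : ∀ p ∈ s, l p ≤ l x := fun p hp => hl p (subset_convexHull ℝ _ hp)
  have hBs : B = convexHull ℝ {p ∈ s | l p = l x} := by rw [hBl, convexHull_inter_eq l hls]
  have hms : ∀ p ∈ {p ∈ s | l p = l x}, m p ≤ m x := fun p hp => hm p (hBs ▸ subset_convexHull ℝ _ hp)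
  have hCs : C = convexHull ℝ {p ∈ {p ∈ s | l p = l x} | m p = m x} := by
    rw [← convexHull_inter_eq m hms, ← hBs]
    exact hCm
  obtain ⟨N, hN⟩ : ∃ N : ℝ, ∀ p ∈ s, l p < l x → m p - m x < N * (l x - l p) := by
    refine Filter.Eventually.exists (f := Filter.atTop) ((Filter.eventually_all_finite hs).2 fun p _ => ?_)
    by_cases h : l p < l x
    · filter_upwards [(Filter.tendsto_id.atTop_mul_const (sub_pos.2 h)).eventually_gt_atTop (m p - m x)]
        with N hN _ using hN
    · exact Filter.Eventually.of_forall fun _ h' => absurd h' h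
  have hg : ∀ p ∈ s, (N • l + m) p ≤ (N • l + m) x ∧
      ((N • l + m) p = (N • l + m) x ↔ l p = l x ∧ m p = m x) := by
    intro p hp
    simp only [add_apply, smul_apply, smul_eq_mul]
    rcases (hls p hp).lt_or_eq with h | h
    · have := hN p hp h
      rw [mul_sub] at this
      exact ⟨by linarith, fun h' => by linarith, fun h' => absurd h'.1 h.ne⟩
    · have := hms p ⟨hp, h⟩
      rw [h]
      exact ⟨by linarith, fun h' => ⟨rfl, by linarith⟩, fun h' => by rw [h'.2]⟩
  have hCg : C = {y ∈ convexHull ℝ s | (N • l + m) y = (N • l + m) x} := by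
    rw [convexHull_inter_eq _ fun p hp => (hg p hp).1, hCs]
    congr 1
    ext p
    exact ⟨fun hp => ⟨hp.1.1, ((hg p hp.1.1).2).2 ⟨hp.1.2, hp.2⟩⟩,
      fun hp => ⟨⟨hp.1, (((hg p hp.1).2).1 hp.2).1⟩, (((hg p hp.1).2).1 hp.2).2⟩⟩
  rw [hCg]
  exact isExposed_of_functional _ fun y hy => le_of_mem_convexHull _ (fun p hp => (hg p hp).1) hy

theorem exposedPoints_convexHull_subset (s : Set E) : (convexHull ℝ s).exposedPoints ℝ ⊆ s :=
  exposedPoints_subset_extremePoints.trans extremePoints_convexHull_subset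

/-- Krein–Milman, once extreme points are known to be exposed: an extreme point is strictly
separated from the hull of the other generators. -/
theorem convexHull_exposedPoints {s : Set E} (hs : s.Finite) :
    convexHull ℝ ((convexHull ℝ s).exposedPoints ℝ) = convexHull ℝ s := by
  have h1 : (convexHull ℝ s).extremePoints ℝ ⊆ (convexHull ℝ s).exposedPoints ℝ := by
    intro x hx
    have hxs : x ∈ s := extremePoints_convexHull_subset hx
    have hx' : x ∉ convexHull ℝ (s \ {x}) := fun h =>
      (extremePoints_convexHull_subset (inter_extremePoints_subset_extremePoints_of_subset
        (convexHull_mono Set.sdiff_subset) ⟨h, hx⟩)).2 rfl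
    obtain ⟨f, u, hf, hu⟩ := geometric_hahn_banach_closed_point (convex_convexHull ℝ _)
      ((hs.subset Set.sdiff_subset).isClosed_convexHull ℝ) hx'
    have hlt : ∀ p ∈ s, p ≠ x → f p < f x := fun p hp hpx =>
      (hf p (subset_convexHull ℝ _ ⟨hp, hpx⟩)).trans hu
    have hle : ∀ p ∈ s, f p ≤ f x := fun p hp => by
      rcases eq_or_ne p x with rfl | h
      exacts [le_rfl, (hlt p hp h).le]
    rw [mem_exposedPoints_iff_exposed_singleton]
    have e : {p ∈ s | f p = f x} = {x} := by
      ext p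
      refine ⟨fun hp => by_contra fun h => (hlt p hp.1 h).ne hp.2, ?_⟩
      rintro rfl
      exact ⟨hxs, rfl⟩
    have h := isExposed_of_functional f fun y hy => le_of_mem_convexHull f hle hy
    rwa [convexHull_inter_eq f hle, e, convexHull_singleton] at h
  apply Set.Subset.antisymm
  · exact convexHull_min exposedPoints_subset (convex_convexHull ℝ s)
  · have h := closure_convexHull_extremePoints (s := convexHull ℝ s) (hs.isCompact_convexHull ℝ)
      (convex_convexHull ℝ s)
    rw [((hs.subset extremePoints_convexHull_subset).isClosed_convexHull ℝ).closure_eq] at h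
    exact h.ge.trans (convexHull_mono h1)

theorem finite_exposedPoints_convexHull {s : Set E} (hs : s.Finite) :
    ((convexHull ℝ s).exposedPoints ℝ).Finite :=
  hs.subset (exposedPoints_convexHull_subset s)

/-- If some functional vanishes on a single ray of the cone that a polytope generates at its
vertex `v`, then this ray contains an edge. -/
theorem exists_edge_of_ray {s : Set E} (hs : s.Finite) {v q : E}
    (hv : v ∈ (convexHull ℝ s).exposedPoints ℝ) (f : StrongDual ℝ E) (hfs : ∀ p ∈ s, f p ≤ f v)
    (hray : ∀ p ∈ s, f p = f v → ∃ μ : ℝ, 0 ≤ μ ∧ p = v + μ • q)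
    (hne : ∃ p ∈ s, p ≠ v ∧ f p = f v) :
    ∃ u ∈ (convexHull ℝ s).exposedPoints ℝ, v ≠ u ∧ IsExposed ℝ (convexHull ℝ s) (segment ℝ v u) ∧
      ∃ μ : ℝ, 0 < μ ∧ u = v + μ • q := by
  have hvs := exposedPoints_convexHull_subset s hv
  choose! μ hμ hpμ using hray
  have hfin : {p ∈ s | f p = f v}.Finite := hs.subset fun p hp => hp.1
  -- The other end of the edge is the generator farthest along the ray.
  obtain ⟨u, hu, humax⟩ := hfin.exists_maximalFor μ _ ⟨v, hvs, rfl⟩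
  have hmax : ∀ p ∈ s, f p = f v → μ p ≤ μ u := fun p hp hpv =>
    (le_total (μ p) (μ u)).elim id fun h => humax ⟨hp, hpv⟩ h
  obtain ⟨p, hp, hpv, hfp⟩ := hne
  have hμp : 0 < μ p := (hμ p hp hfp).lt_of_ne fun h => hpv (by
    rw [hpμ p hp hfp, ← h, zero_smul, add_zero])
  have hμu : 0 < μ u := hμp.trans_le (hmax p hp hfp)
  have hq : q ≠ 0 := fun h => hpv (by rw [hpμ p hp hfp, h, smul_zero, add_zero])
  have hvu : v ≠ u := fun h => by
    have h1 := hpμ u hu.1 hu.2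
    rw [← h, left_eq_add, smul_eq_zero, h] at h1
    exact h1.elim hμu.ne' hq
  have hseg : IsExposed ℝ (convexHull ℝ s) (segment ℝ v u) := by
    convert isExposed_of_functional f fun y hy => le_of_mem_convexHull f hfs hy
    rw [convexHull_inter_eq f hfs]
    apply Set.Subset.antisymm
    · exact (convex_convexHull ℝ _).segment_subset (subset_convexHull ℝ _ ⟨hvs, rfl⟩)
        (subset_convexHull ℝ _ hu)
    · refine convexHull_min ?_ (convex_segment v u)
      rintro p ⟨hp, hpf⟩
      rw [segment_eq_image']
      refine ⟨μ p / μ u, ⟨div_nonneg (hμ p hp hpf) hμu.le, (div_le_one hμu).2 (hmax p hp hpf)⟩, ?_⟩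
      have h1 : u - v = μ u • q := sub_eq_iff_eq_add'.2 (hpμ u hu.1 hu.2)
      dsimp only
      rw [h1, smul_smul, div_mul_cancel₀ _ hμu.ne', ← hpμ p hp hpf]
  refine ⟨u, ?_, hvu, hseg, μ u, hμu, hpμ u hu.1 hu.2⟩
  rw [mem_exposedPoints_iff_exposed_singleton]
  refine hseg.trans_of_finite hs ?_
  obtain ⟨g, hg⟩ := geometric_hahn_banach_point_point (E := E) hvu
  have hg' : ∀ p ∈ ({v, u} : Set E), g p ≤ g u := by
    rintro p (rfl | rfl)
    exacts [hg.le, le_rfl]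
  rw [← convexHull_pair]
  have e : {p ∈ ({v, u} : Set E) | g p = g u} = {u} := by
    ext p
    constructor
    · rintro ⟨rfl | rfl, h⟩
      exacts [absurd h hg.ne, rfl]
    · rintro rfl
      exact ⟨Or.inr rfl, rfl⟩
  have h := isExposed_of_functional g fun y hy => le_of_mem_convexHull g hg' hy
  rwa [convexHull_inter_eq g hg', e, convexHull_singleton] at h

/-- The cone that a polytope generates at a vertex is generated by the edges at this vertex. -/
theorem sub_mem_hull_neighborSet {P : Set E} (hP : ∃ s : Finset E, P = convexHull ℝ (s : Set E))
    (v : P.exposedPoints ℝ) {x : E} (hx : x ∈ P) :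
    x - v ∈ PointedCone.hull ℝ
      ((fun u : P.exposedPoints ℝ => (u : E) - v) '' (polytopeGraph P).neighborSet v) := by
  obtain ⟨s, rfl⟩ := hP
  obtain ⟨v, hv⟩ := v
  set K := PointedCone.hull ℝ ((fun u : (convexHull ℝ (s : Set E)).exposedPoints ℝ => (u : E) - v) ''
      (polytopeGraph (convexHull ℝ (s : Set E))).neighborSet ⟨v, hv⟩)
  have hvP := hv
  obtain ⟨-, a, ha⟩ := hvP
  have hlt : ∀ p ∈ (s : Set E), p ≠ v → 0 < a v - a p := fun p hp hpv =>
    sub_pos.2 (lt_of_not_ge fun h => hpv ((ha p (subset_convexHull ℝ _ hp)).2 h))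
  -- The vertex figure: directions from `v` are rescaled to the hyperplane `a = -1`. Its vertices
  -- are shown to lie on edge rays.
  set q : E → E := fun p => (a v - a p)⁻¹ • (p - v) with hq
  have haq : ∀ p ∈ (s : Set E), p ≠ v → a (q p) = -1 := fun p hp hpv => by
    have := (hlt p hp hpv).ne'
    simp only [hq, map_smul, map_sub, smul_eq_mul]
    field_simp
    ring
  have hpq : ∀ p ∈ (s : Set E), p ≠ v → p = v + (a v - a p) • q p := fun p hp hpv => by
    simp only [hq]
    rw [smul_smul, mul_inv_cancel₀ (hlt p hp hpv).ne', one_smul, add_sub_cancel]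
  have hfin : (q '' ((s : Set E) \ {v})).Finite := (s.finite_toSet.subset Set.sdiff_subset).image q
  have hvert : (convexHull ℝ (q '' ((s : Set E) \ {v}))).exposedPoints ℝ ⊆ K := by
    intro y hy
    obtain ⟨p₀, ⟨hp₀, hp₀v⟩, rfl⟩ := exposedPoints_convexHull_subset _ hy
    obtain ⟨-, g, hg⟩ := hy
    have hgq : ∀ p ∈ (s : Set E), p ≠ v → g (q p) ≤ g (q p₀) ∧ (g (q p₀) ≤ g (q p) → q p = q p₀) :=
      fun p hp hpv => hg _ (subset_convexHull ℝ _ ⟨p, ⟨hp, hpv⟩, rfl⟩)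
    -- As `a = -1` on the vertex figure, `f` is nonpositive there and vanishes only where `g` is
    -- maximal, at `q p₀`.
    set f : StrongDual ℝ E := g + g (q p₀) • a with hf
    have hfp : ∀ p ∈ (s : Set E), p ≠ v → f p = f v + (a v - a p) * (g (q p) - g (q p₀)) := by
      intro p hp hpv
      conv_lhs => rw [hpq p hp hpv, map_add, map_smul]
      have : f (q p) = g (q p) - g (q p₀) := by
        simp only [hf, add_apply, smul_apply, haq p hp hpv, smul_eq_mul]
        ring
      rw [this, smul_eq_mul]
    obtain ⟨u, hu, hvu, hseg, μ, hμ, huμ⟩ := exists_edge_of_ray s.finite_toSet hv (q := q p₀) f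
      (by
        intro p hp
        rcases eq_or_ne p v with rfl | hpv
        · exact le_rfl
        · rw [hfp p hp hpv]
          have := mul_nonneg (hlt p hp hpv).le (sub_nonneg.2 (hgq p hp hpv).1)
          linarith)
      (by
        intro p hp hpf
        rcases eq_or_ne p v with rfl | hpv
        · exact ⟨0, le_rfl, by simp⟩
        · refine ⟨_, (hlt p hp hpv).le, ?_⟩
          rw [hfp p hp hpv, add_eq_left, mul_eq_zero] at hpf
          rw [← (hgq p hp hpv).2 (sub_eq_zero.1 (hpf.resolve_left (hlt p hp hpv).ne')).ge]
          exact hpq p hp hpv)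
      ⟨p₀, hp₀, hp₀v, by rw [hfp p₀ hp₀ hp₀v, sub_self, mul_zero, add_zero]⟩
    have hmem : u - v ∈ K := PointedCone.subset_hull
      ⟨⟨u, hu⟩, ⟨fun h => hvu (congrArg Subtype.val h), hseg⟩, rfl⟩
    have : q p₀ = μ⁻¹ • (u - v) := by
      rw [huμ, add_sub_cancel_left, smul_smul, inv_mul_cancel₀ hμ.ne', one_smul]
    rw [this]
    exact K.smul_mem (inv_nonneg.2 hμ.le) hmem
  have hQ : convexHull ℝ (q '' ((s : Set E) \ {v})) ⊆ K := by
    rw [← convexHull_exposedPoints hfin]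
    exact convexHull_min hvert K.convex
  have hsK : (s : Set E) ⊆ (fun x => x - v) ⁻¹' (K : Set E) := by
    intro p hp
    rcases eq_or_ne p v with rfl | hpv
    · simp
    · have h := hQ (subset_convexHull ℝ _ ⟨p, ⟨hp, hpv⟩, rfl⟩)
      have h2 := K.smul_mem (hlt p hp hpv).le h
      rwa [← sub_eq_iff_eq_add'.2 (hpq p hp hpv)] at h2
  have hconv : Convex ℝ ((fun x => x - v) ⁻¹' (K : Set E)) := by
    simp only [sub_eq_add_neg]
    exact K.convex.translate_preimage_left (-v)
  exact convexHull_min hsK hconv hx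

end Faces

/-! ### Faces of simple polytopes as `k`-systems, and AOF-orientations. -/

section FaceSystems

variable {E : Type*} [NormedAddCommGroup E] [NormedSpace ℝ E] {P F F' : Set E}

theorem finite_exposedPoints_of_polytope (hP : ∃ s : Finset E, P = convexHull ℝ (s : Set E)) :
    Finite (P.exposedPoints ℝ) := by
  obtain ⟨s, rfl⟩ := hP
  exact (finite_exposedPoints_convexHull s.finite_toSet).to_subtype

theorem faceVertices_nonempty (hP : ∃ s : Finset E, P = convexHull ℝ (s : Set E))
    (hF : IsExposed ℝ P F) (hne : F.Nonempty) : (faceVertices P F).Nonempty := by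
  obtain ⟨s, rfl⟩ := hP
  rw [← convexHull_exposedPoints s.finite_toSet] at hF
  rw [hF.eq_convexHull, convexHull_nonempty_iff] at hne
  obtain ⟨v, hv, hvF⟩ := hne
  exact ⟨⟨v, hv⟩, hvF⟩

/-- The functional `l` exposing `F` is nonpositive on all edge directions at `v`. Where `l`
vanishes, only edges inside `F` can contribute. -/
theorem sub_mem_hull_faceVertices (hP : ∃ s : Finset E, P = convexHull ℝ (s : Set E))
    (hF : IsExposed ℝ P F) {v : P.exposedPoints ℝ} (hv : v ∈ faceVertices P F) {x : E} (hx : x ∈ F) :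
    x - v ∈ PointedCone.hull ℝ ((fun u : P.exposedPoints ℝ => (u : E) - v) ''
      ((polytopeGraph P).neighborSet v ∩ faceVertices P F)) := by
  obtain ⟨l, hl, hFl⟩ := hF.exists_functional (show (v : E) ∈ F from hv)
  set K := PointedCone.hull ℝ ((fun u : P.exposedPoints ℝ => (u : E) - v) ''
      ((polytopeGraph P).neighborSet v ∩ faceVertices P F))
  have key : ∀ y ∈ PointedCone.hull ℝ
      ((fun u : P.exposedPoints ℝ => (u : E) - v) '' (polytopeGraph P).neighborSet v),
      l y ≤ 0 ∧ (l y = 0 → y ∈ K) := by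
    intro y hy
    induction hy using Submodule.span_induction with
    | mem y hy =>
      obtain ⟨u, hu, rfl⟩ := hy
      simp only [map_sub]
      refine ⟨sub_nonpos.2 (hl u u.2.1), fun h => PointedCone.subset_hull ⟨u, ⟨hu, ?_⟩, rfl⟩⟩
      change (u : E) ∈ F
      rw [hFl]
      exact ⟨u.2.1, sub_eq_zero.1 h⟩
    | zero => exact ⟨by simp, fun _ => K.zero_mem⟩
    | add y z _ _ hy hz =>
      rw [map_add]
      exact ⟨add_nonpos hy.1 hz.1, fun h => K.add_mem (hy.2 (by linarith [hy.1, hz.1]))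
        (hz.2 (by linarith [hy.1, hz.1]))⟩
    | smul r y _ hy =>
      have e : l (r • y) = (r : ℝ) * l y := by
        rw [show r • y = (r : ℝ) • y from rfl, map_smul, smul_eq_mul]
      rw [e]
      refine ⟨mul_nonpos_of_nonneg_of_nonpos r.2 hy.1, fun h => ?_⟩
      rcases mul_eq_zero.1 h with h | h
      · have : r = 0 := Subtype.ext h
        rw [this, zero_smul]
        exact K.zero_mem
      · exact Submodule.smul_mem K r (hy.2 h)
  rw [hFl] at hx
  exact (key _ (sub_mem_hull_neighborSet hP v hx.1)).2 (by rw [map_sub, hx.2, sub_self])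

theorem apply_nonpos_of_mem_hull {A : Set E} (c : E →ₗ[ℝ] ℝ) (hc : ∀ y ∈ A, c y ≤ 0) {y : E}
    (hy : y ∈ PointedCone.hull ℝ A) : c y ≤ 0 := by
  induction hy using Submodule.span_induction with
  | mem y hy => exact hc y hy
  | zero => simp
  | add y z _ _ hy hz =>
    rw [map_add]
    exact add_nonpos hy hz
  | smul r y _ hy =>
    rw [show r • y = (r : ℝ) • y from rfl, map_smul, smul_eq_mul]
    exact mul_nonpos_of_nonneg_of_nonpos r.2 hy

/-- A vertex of a face that is a local maximum of a linear functional is a global maximum. -/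
theorem apply_le_of_forall_neighbor (hP : ∃ s : Finset E, P = convexHull ℝ (s : Set E))
    (hF : IsExposed ℝ P F) {v : P.exposedPoints ℝ} (hv : v ∈ faceVertices P F) (c : E →ₗ[ℝ] ℝ)
    (hc : ∀ u ∈ (polytopeGraph P).neighborSet v ∩ faceVertices P F, c u ≤ c v) {x : E}
    (hx : x ∈ F) : c x ≤ c v := by
  have h := apply_nonpos_of_mem_hull c (by
    rintro _ ⟨u, hu, rfl⟩
    simpa using hc u hu) (sub_mem_hull_faceVertices hP hF hv hx)
  simpa using h

/-- The functional exposing `F'` has a local minimum over `F` at `v`, hence a global one; but its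
value at `v` is also its maximum on `P`. -/
theorem face_subset_face (hP : ∃ s : Finset E, P = convexHull ℝ (s : Set E))
    (hF : IsExposed ℝ P F) (hF' : IsExposed ℝ P F') {v : P.exposedPoints ℝ}
    (hv : v ∈ faceVertices P F) (hv' : v ∈ faceVertices P F')
    (h : (polytopeGraph P).neighborSet v ∩ faceVertices P F ⊆ faceVertices P F') : F ⊆ F' := by
  obtain ⟨l, hl, hFl⟩ := hF'.exists_functional (show (v : E) ∈ F' from hv')
  intro x hx
  have h1 := apply_le_of_forall_neighbor hP hF hv (-(l : E →ₗ[ℝ] ℝ)) (by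
    intro u hu
    have h2 : (u : E) ∈ F' := h hu
    rw [hFl] at h2
    simp [h2.2]) hx
  have hxP := hF.subset hx
  rw [hFl]
  refine ⟨hxP, le_antisymm (hl x hxP) ?_⟩
  simpa using h1

theorem vectorSpan_face (hP : ∃ s : Finset E, P = convexHull ℝ (s : Set E))
    (hF : IsExposed ℝ P F) {v : P.exposedPoints ℝ} (hv : v ∈ faceVertices P F) :
    vectorSpan ℝ F = Submodule.span ℝ ((fun u : P.exposedPoints ℝ => (u : E) - v) ''
      ((polytopeGraph P).neighborSet v ∩ faceVertices P F)) := by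
  rw [vectorSpan_eq_span_vsub_set_right ℝ (show (v : E) ∈ F from hv)]
  apply le_antisymm
  · rw [Submodule.span_le]
    rintro _ ⟨x, hx, rfl⟩
    exact PointedCone.hull_le_span ℝ _ (sub_mem_hull_faceVertices hP hF hv hx)
  · apply Submodule.span_mono
    rintro _ ⟨u, hu, rfl⟩
    exact ⟨u, hu.2, rfl⟩

variable {d : ℕ}

/-- Simplicity enters here: the `d` edge directions span a space of dimension `d`. -/
theorem IsSimplePolytope.linearIndepOn_neighborSet (hP : IsSimplePolytope P d)
    (v : P.exposedPoints ℝ) : LinearIndepOn ℝ (fun u : P.exposedPoints ℝ => (u : E) - v)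
      ((polytopeGraph P).neighborSet v) := by
  classical
  have := finite_exposedPoints_of_polytope hP.polytope
  have := Fintype.ofFinite ((polytopeGraph P).neighborSet v)
  have hvP : v ∈ faceVertices P P := v.2.1
  have huniv : faceVertices P P = Set.univ := Set.eq_univ_of_forall fun u => u.2.1
  have h := vectorSpan_face hP.polytope (IsExposed.refl P) hvP
  rw [huniv, Set.inter_univ] at h
  unfold LinearIndepOn
  rw [linearIndependent_iff_card_eq_finrank_span, Set.finrank,
    ← Set.image_eq_range (fun u : P.exposedPoints ℝ => (u : E) - v),
    ← h, hP.dim_eq, ← hP.degree_eq v, Set.ncard_eq_toFinset_card', Set.toFinset_card]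

theorem IsSimplePolytope.finrank_face (hP : IsSimplePolytope P d) (hF : IsExposed ℝ P F)
    {v : P.exposedPoints ℝ} (hv : v ∈ faceVertices P F) :
    Module.finrank ℝ (vectorSpan ℝ F) =
      ((polytopeGraph P).neighborSet v ∩ faceVertices P F).ncard := by
  classical
  have := finite_exposedPoints_of_polytope hP.polytope
  have := Fintype.ofFinite
    ((polytopeGraph P).neighborSet v ∩ faceVertices P F : Set (P.exposedPoints ℝ))
  have h := (hP.linearIndepOn_neighborSet v).mono
    (Set.inter_subset_left (t := faceVertices P F))
  unfold LinearIndepOn at h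
  rw [linearIndependent_iff_card_eq_finrank_span, Set.finrank,
    ← Set.image_eq_range (fun u : P.exposedPoints ℝ => (u : E) - v),
    ← vectorSpan_face hP.polytope hF hv] at h
  rw [← h, Set.ncard_eq_toFinset_card', Set.toFinset_card]

/-- Any set of edges at a vertex of a simple polytope spans a face. -/
theorem IsSimplePolytope.exists_face [FiniteDimensional ℝ E] (hP : IsSimplePolytope P d)
    (v : P.exposedPoints ℝ) {L : Set (P.exposedPoints ℝ)}
    (hL : L ⊆ (polytopeGraph P).neighborSet v) :
    ∃ F, IsExposed ℝ P F ∧ v ∈ faceVertices P F ∧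
      (polytopeGraph P).neighborSet v ∩ faceVertices P F = L := by
  classical
  have hli := hP.linearIndepOn_neighborSet v
  let b := Module.Basis.span hli
  -- By independence, `c` can be prescribed as `0` on the edges to `L` and `-1` on the others; it
  -- then exposes the desired face.
  obtain ⟨c, hc⟩ := LinearMap.exists_extend
    (b.constr ℝ fun u : (polytopeGraph P).neighborSet v => if (u : P.exposedPoints ℝ) ∈ L then (0 : ℝ) else -1)
  have hcu : ∀ u ∈ (polytopeGraph P).neighborSet v, c (u : E) = c v + if u ∈ L then 0 else -1 := by
    intro u hu
    have h1 := LinearMap.congr_fun hc (b ⟨u, hu⟩)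
    rw [Module.Basis.constr_basis, LinearMap.comp_apply, Submodule.subtype_apply,
      show (b ⟨u, hu⟩ : E) = u - v from
        congrArg Subtype.val (Module.Basis.span_apply hli ⟨u, hu⟩), map_sub] at h1
    exact sub_eq_iff_eq_add'.1 h1
  have hmax : ∀ y ∈ P, c y ≤ c v := fun y hy =>
    apply_le_of_forall_neighbor hP.polytope (IsExposed.refl P) (show v ∈ faceVertices P P from v.2.1) c
      (fun u hu => by
        rw [hcu u hu.1]
        split_ifs <;> simp) hy
  refine ⟨_, isExposed_of_functional (LinearMap.toContinuousLinearMap c) hmax, ⟨v.2.1, rfl⟩, ?_⟩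
  ext u
  constructor
  · rintro ⟨hu, -, hcuv⟩
    by_contra huL
    have h2 := hcu u hu
    rw [if_neg huL] at h2
    change c (u : E) = c v at hcuv
    linarith
  · intro hu
    refine ⟨hL hu, u.2.1, ?_⟩
    change c (u : E) = c v
    rw [hcu u (hL hu), if_pos hu, add_zero]

/-- The vertex sets of the `k`-dimensional faces. -/
def faceSystem (P : Set E) (k : ℕ) : Set (Set (P.exposedPoints ℝ)) :=
  {W | ∃ F, IsExposed ℝ P F ∧ F.Nonempty ∧ Module.finrank ℝ (vectorSpan ℝ F) = k ∧
    W = faceVertices P F}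

/-- Dimension equals degree within a face, so a `k`-face containing the frame has exactly the
frame's edges at `r`, and these determine it. -/
theorem IsSimplePolytope.isKSystem_faceSystem [FiniteDimensional ℝ E] (hP : IsSimplePolytope P d)
    (k : ℕ) : IsKSystem (polytopeGraph P) k (faceSystem P k) := by
  have := finite_exposedPoints_of_polytope hP.polytope
  constructor
  · rintro _ ⟨F, hF, hne, rfl, rfl⟩
    refine ⟨faceVertices_nonempty hP.polytope hF hne, fun w => ?_⟩
    rw [ncard_neighborSet_induce, hP.finrank_face hF w.2]
  · intro r L hL
    obtain ⟨F, hF, hr, hN⟩ := hP.exists_face r hL.1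
    have hk : Module.finrank ℝ (vectorSpan ℝ F) = k := by rw [hP.finrank_face hF hr, hN, hL.2.2]
    refine ⟨faceVertices P F, ⟨⟨F, hF, ⟨r, hr⟩, hk, rfl⟩,
      Set.insert_subset hr (hN ▸ Set.inter_subset_right)⟩, ?_⟩
    rintro _ ⟨⟨F', hF', hne', hk', rfl⟩, hrL⟩
    have hr' := hrL (Set.mem_insert r L)
    have hN' : L = (polytopeGraph P).neighborSet r ∩ faceVertices P F' := by
      apply Set.eq_of_subset_of_ncard_le
        (Set.subset_inter hL.1 ((Set.subset_insert r L).trans hrL))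
      rw [← hP.finrank_face hF' hr', hk', hL.2.2]
    congr 1
    apply Set.Subset.antisymm
    · exact face_subset_face hP.polytope hF' hF hr' hr (by
        rw [← hN', ← hN]
        exact Set.inter_subset_right)
    · exact face_subset_face hP.polytope hF hF' hr hr' (by
        rw [hN, hN']
        exact Set.inter_subset_right)

/-- The orientation of the edges of `P` along which a functional increases. -/
def orientationOfFunctional (c : E →ₗ[ℝ] ℝ)
    (hc : Function.Injective fun v : P.exposedPoints ℝ => c v) :
    GraphOrientation (polytopeGraph P) where
  arc u v := (polytopeGraph P).Adj u v ∧ c u < c v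
  adj_iff u v := by
    refine ⟨fun h => ?_, fun h => h.elim And.left fun h => h.1.symm⟩
    exact (hc.ne h.ne).lt_or_gt.imp (fun h' => ⟨h, h'⟩) fun h' => ⟨h.symm, h'⟩
  asymm u v h h' := lt_asymm h.2 h'.2

theorem orientationOfFunctional_acyclic (c : E →ₗ[ℝ] ℝ)
    (hc : Function.Injective fun v : P.exposedPoints ℝ => c v) :
    (orientationOfFunctional c hc).Acyclic := by
  intro v hv
  have : ∀ u w, Relation.TransGen (orientationOfFunctional c hc).arc u w → c (u : E) < c w := by
    intro u w h
    induction h with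
    | single h => exact h.2
    | tail _ h ih => exact ih.trans h.2
  exact lt_irrefl _ (this v v hv)

/-- A sink on a face is a local, hence global, maximum of `c` there; injectivity makes it unique. -/
theorem isAOFOrientation_orientationOfFunctional
    (hP : ∃ s : Finset E, P = convexHull ℝ (s : Set E)) (c : E →ₗ[ℝ] ℝ)
    (hc : Function.Injective fun v : P.exposedPoints ℝ => c v) :
    IsAOFOrientation P (orientationOfFunctional c hc) := by
  have := finite_exposedPoints_of_polytope hP
  refine ⟨orientationOfFunctional_acyclic c hc, fun F hF hne => ?_⟩
  obtain ⟨w, hw⟩ := (orientationOfFunctional_acyclic c hc).exists_isSinkOn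
    (faceVertices_nonempty hP hF hne)
  have hmax : ∀ w, (orientationOfFunctional c hc).IsSinkOn (faceVertices P F) w →
      ∀ x ∈ F, c x ≤ c w := fun w hw x hx =>
    apply_le_of_forall_neighbor hP hF hw.1 c
      (fun u hu => not_lt.1 fun h => hw.2 u hu.2 ⟨hu.1, h⟩) hx
  exact ⟨w, hw, fun w' hw' => hc (le_antisymm (hmax w hw _ hw'.1) (hmax w' hw' _ hw.1))⟩

theorem exists_isAOFOrientation [FiniteDimensional ℝ E]
    (hP : ∃ s : Finset E, P = convexHull ℝ (s : Set E)) :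
    ∃ O : GraphOrientation (polytopeGraph P), IsAOFOrientation P O := by
  have := finite_exposedPoints_of_polytope hP
  obtain ⟨c, hc⟩ := Module.exists_dual_forall_apply_ne_zero (K := ℝ)
    (fun p : {p : P.exposedPoints ℝ × P.exposedPoints ℝ // p.1 ≠ p.2} => (p.1.1 : E) - p.1.2)
    (fun p => sub_ne_zero.2 fun h => p.2 (Subtype.ext h))
  have hinj : Function.Injective fun v : P.exposedPoints ℝ => c v := fun u v huv => by
    by_contra h
    refine hc ⟨(u, v), h⟩ ?_
    rw [map_sub]
    exact sub_eq_zero.2 huv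
  exact ⟨_, isAOFOrientation_orientationOfFunctional hP c hinj⟩

/-- An acyclic orientation of the graph of a simple polytope with a unique sink in every 2-face
has a unique sink in every face. -/
theorem IsSimplePolytope.isAOFOrientation_iff [FiniteDimensional ℝ E] (hP : IsSimplePolytope P d)
    {O : GraphOrientation (polytopeGraph P)} (hO : O.Acyclic) :
    IsAOFOrientation P O ↔ ∀ W ∈ faceSystem P 2, ∃! w, O.IsSinkOn W w := by
  have := finite_exposedPoints_of_polytope hP.polytope
  constructor
  · rintro h _ ⟨F, hF, hne, -, rfl⟩
    exact h.2 F hF hne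
  intro h
  refine ⟨hO, fun F hF hne => ?_⟩
  -- `O'` serves only to show that `F` is connected: all its vertices have directed paths to the one
  -- sink of `O'`.
  obtain ⟨O', hO'⟩ := exists_isAOFOrientation hP.polytope
  obtain ⟨b, hb, hbu⟩ := hO'.2 F hF hne
  refine hO.existsUnique_isSinkOn ?_ hb.1 ?_
  · intro v hv u hu w hw huw hvu hvw
    have hL : {u, w} ⊆ (polytopeGraph P).neighborSet v := by
      rintro x (rfl | rfl)
      exacts [(O.adj_iff _ _).2 (Or.inl hvu), (O.adj_iff _ _).2 (Or.inl hvw)]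
    obtain ⟨T, hT, hvT, hN⟩ := hP.exists_face v hL
    have hmem : ∀ x ∈ ({u, w} : Set (P.exposedPoints ℝ)), x ∈ faceVertices P T := fun x hx => by
      rw [← hN] at hx
      exact hx.2
    have hTF : T ⊆ F := face_subset_face hP.polytope hT hF hvT hv (by
      rw [hN]
      rintro x (rfl | rfl)
      exacts [hu, hw])
    exact ⟨faceVertices P T, fun x hx => hTF hx, hmem u (Or.inl rfl), hmem w (Or.inr rfl),
      h _ ⟨T, hT, ⟨v, hvT⟩, by rw [hP.finrank_face hT hvT, hN, Set.ncard_pair huw], rfl⟩⟩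
  · intro a ha
    obtain ⟨w, hw, haw⟩ := hO'.1.exists_reachable_isSinkOn ha
    rw [← hbu w hw]
    exact Relation.ReflTransGen.mono
      (fun x y hxy => ⟨(O'.adj_iff x y).2 (Or.inl hxy.1), hxy.2⟩) _ _ haw

/-- The AOF-orientations of a simple polytope are the acyclic orientations for which `H 2` is the
number of 2-faces. -/
theorem IsSimplePolytope.isAOFOrientation_iff_ncard [FiniteDimensional ℝ E]
    (hP : IsSimplePolytope P d) {O : GraphOrientation (polytopeGraph P)} (hO : O.Acyclic) :
    IsAOFOrientation P O ↔ (faceSystem P 2).ncard = O.H d 2 := by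
  have := finite_exposedPoints_of_polytope hP.polytope
  rw [hP.isAOFOrientation_iff hO, (hP.isKSystem_faceSystem 2).ncard_eq_iff hO hP.degree_eq]

end FaceSystems

theorem mainTheorem6 {E : Type*} [NormedAddCommGroup E] [NormedSpace ℝ E] [FiniteDimensional ℝ E]
    (P : Set E) (d : ℕ) (hP : IsSimplePolytope P d)
    (O : GraphOrientation (polytopeGraph P)) (hO : O.Acyclic) :
    Xor (∃ S : Set (Set (P.exposedPoints ℝ)),
            IsKSystem (polytopeGraph P) 2 S ∧ S.ncard = O.H d 2)
         (∃ O' : GraphOrientation (polytopeGraph P), O'.Acyclic ∧ O'.H d 2 < O.H d 2) ∧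
    ((∃ S : Set (Set (P.exposedPoints ℝ)),
            IsKSystem (polytopeGraph P) 2 S ∧ S.ncard = O.H d 2) →
        IsAOFOrientation P O) ∧
    ((∃ O' : GraphOrientation (polytopeGraph P), O'.Acyclic ∧ O'.H d 2 < O.H d 2) →
        ¬ IsAOFOrientation P O) := by
  have := finite_exposedPoints_of_polytope hP.polytope
  have hT := hP.isKSystem_faceSystem 2
  obtain ⟨A, hA⟩ := exists_isAOFOrientation hP.polytope
  have hAH := (hP.isAOFOrientation_iff_ncard hA.1).1 hA
  have hTO := hT.ncard_le hO hP.degree_eq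
  have h12 : (∃ S : Set (Set (P.exposedPoints ℝ)),
      IsKSystem (polytopeGraph P) 2 S ∧ S.ncard = O.H d 2) →
      ¬ ∃ O' : GraphOrientation (polytopeGraph P), O'.Acyclic ∧ O'.H d 2 < O.H d 2 := by
    rintro ⟨S, hS, hSO⟩ ⟨O', hO', hlt⟩
    have := hS.ncard_le hO' hP.degree_eq
    omega
  refine ⟨?_, ?_, ?_⟩
  · rcases hTO.lt_or_eq with h | h
    · have h2 : ∃ O' : GraphOrientation (polytopeGraph P), O'.Acyclic ∧ O'.H d 2 < O.H d 2 :=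
        ⟨A, hA.1, hAH ▸ h⟩
      exact Or.inr ⟨h2, fun h1 => h12 h1 h2⟩
    · exact Or.inl ⟨⟨_, hT, h⟩, h12 ⟨_, hT, h⟩⟩
  · rintro ⟨S, hS, hSO⟩
    rw [hP.isAOFOrientation_iff_ncard hO]
    -- `|S| ≤ H_2(A)`, which is the number of 2-faces, and this is at most `H_2(O) = |S|`; so
    -- equality holds throughout.
    have := hS.ncard_le hA.1 hP.degree_eq
    omega
  · intro h hAOF
    exact h12 ⟨_, hT, (hP.isAOFOrientation_iff_ncard hO).1 hAOF⟩ h
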